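/- Let $\tau>0$. For every $N\ge 1$ let $A_N$ be an $N\times N$ complex Ginibre matrix with i.i.d. entries $a_{ij}\sim\mathcal N_{\mathbb C}(0,\tau/N)$ (independent centred real Gaussian real and imaginary parts of variance $\tau/(2N)$ each), and let $E_N$ be a conditional expectation of $M_N(\mathbb C)$ onto a unital $*$-subalgebra $\mathcal B_N$ (a unital, completely positive, idempotent, $\mathcal B_N$-bimodular linear map with range $\mathcal B_N$). Put \[ c_m^{(N)}=\frac1N\operatorname{Tr}\mathbb E\big[A_N^m(A_N^m)^*\big],\qquad K_N(m,n)=E_N\big(\mathbb E[A_N^m(A_N^n)^*]\big),\qquad (K_N)_\Sigma(m,n)=K_N(m+1,n+1)\qquad(m,n\ge 0). \] For $M_N(\mathbb C)$-valued kernels $K,L$ on a set $S\subseteq\{0,1,2,\dots\}$ write $K\le L$ on $S$ if $\sum_{a,b}\langle u_a,(L-K)(x_a,x_b)u_b\rangle\ge0$ for all finite families $x_a\in S$, $u_a\in\mathbb C^N$. All the moments above exist (the entries of $A_N^m(A_N^n)^*$ are integrable), and: 1. for every $m\ge0$, $c_m^{(N)}\to\tau^m$ as $N\to\infty$; 2.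 for every $m\ge0$, $c_{m+1}^{(N)}/c_m^{(N)}\to\tau$ as $N\to\infty$; 3. (limiting kernel) for all $m,n\ge 0$, $\|K_N(m,n)-\delta_{mn}\tau^m I_N\|\to0$ as $N\to\infty$ (operator norm), and for every $N\ge1$ the kernel $L_N(m,n)=\delta_{mn}\tau^mI_N$ and its shift $(L_N)_\Sigma(m,n)=L_N(m+1,n+1)$ satisfy $(L_N)_\Sigma\le L_N$ on $\{0,1,2,\dots\}$ if and only if $\tau\le1$; 4. (asymptotic criterion) the following holds if and only if $\tau\le1$: for every $\varepsilon>0$ and every $M\ge 0$, for all sufficiently large $N$, $(K_N)_\Sigma\le(1+\varepsilon)K_N$ on $\{0,\dots,M\}$. Moreover, if $\tau<1$, then for every $M$ one has $(K_N)_\Sigma\le K_N$ on $\{0,\dots,M\}$ for all sufficiently large $N$; and if $\tau>1$, then for every $N\ge1$ the inequality $(K_N)_\Sigma\le K_N$ fails already on $\{0\}$. -/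

import Mathlib

open MeasureTheory ProbabilityTheory Filter Topology
open scoped NNReal

noncomputable section

namespace GinibreKernel

/-- The law `𝒩_ℂ(0, v)`: real and imaginary parts are independent centred real Gaussians of
variance `v / 2`, so that `𝔼 |z|² = v`. -/
def complexGaussian (v : ℝ≥0) : Measure ℂ :=
  ((gaussianReal 0 (v / 2)).prod (gaussianReal 0 (v / 2))).map
    Complex.measurableEquivRealProd.symm

/-- `A` is an `N × N` complex Ginibre matrix with entry variance `v`: its entries are
independent and each has law `𝒩_ℂ(0, v)`. -/
structure IsComplexGinibre {Ω : Type*} [MeasurableSpace Ω] (P : Measure Ω) {N : ℕ}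
    (A : Ω → Matrix (Fin N) (Fin N) ℂ) (v : ℝ≥0) : Prop where
  indep : iIndepFun (fun (p : Fin N × Fin N) (ω : Ω) => A ω p.1 p.2) P
  law : ∀ i j, HasLaw (fun ω => A ω i j) (complexGaussian v) P

/-- The moment kernel `K(m, n) = 𝔼[A^m (A^n)*]`, the expectation being taken entrywise. -/
def momentKernel {Ω : Type*} [MeasurableSpace Ω] (P : Measure Ω) {N : ℕ}
    (A : Ω → Matrix (Fin N) (Fin N) ℂ) (m n : ℕ) : Matrix (Fin N) (Fin N) ℂ :=
  Matrix.of fun i j => ∫ ω, (A ω ^ m * (A ω ^ n).conjTranspose) i j ∂P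

/-- The normalized moment `c_m = (1/N) Tr 𝔼[A^m (A^m)*]`. The trace is a nonnegative real
number, so that taking its real part loses nothing. -/
def normMoment {Ω : Type*} [MeasurableSpace Ω] (P : Measure Ω) {N : ℕ}
    (A : Ω → Matrix (Fin N) (Fin N) ℂ) (m : ℕ) : ℝ :=
  (1 / (N : ℝ)) * (momentKernel P A m m).trace.re

open scoped Matrix.Norms.L2Operator MatrixOrder CStarAlgebra in
/-- `E` is a conditional expectation (in the sense of Tomiyama) of `M_N(ℂ)` onto the unital
`*`-subalgebra `B`: a unital, completely positive, `B`-bimodular idempotent map with range `B`. -/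
structure IsCondExp {N : ℕ} (B : StarSubalgebra ℂ (Matrix (Fin N) (Fin N) ℂ))
    (E : Matrix (Fin N) (Fin N) ℂ →ₗ[ℂ] Matrix (Fin N) (Fin N) ℂ) : Prop where
  map_one : E 1 = 1
  completelyPositive :
    ∃ Φ : Matrix (Fin N) (Fin N) ℂ →CP Matrix (Fin N) (Fin N) ℂ, Φ.toLinearMap = E
  idempotent : ∀ T, E (E T) = E T
  range_eq : Set.range E = (B : Set (Matrix (Fin N) (Fin N) ℂ))
  bimodular : ∀ b₁ ∈ B, ∀ b₂ ∈ B, ∀ T, E (b₁ * T * b₂) = b₁ * E T * b₂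

/-- The localized moment kernel `K_B = E ∘ K`. -/
def localKernel {Ω : Type*} [MeasurableSpace Ω] (P : Measure Ω) {N : ℕ}
    (A : Ω → Matrix (Fin N) (Fin N) ℂ)
    (E : Matrix (Fin N) (Fin N) ℂ →ₗ[ℂ] Matrix (Fin N) (Fin N) ℂ) (m n : ℕ) :
    Matrix (Fin N) (Fin N) ℂ :=
  E (momentKernel P A m n)

/-- The shifted kernel `K_Σ(m, n) = K(m + 1, n + 1)`. -/
def shiftKernel {N : ℕ} (K : ℕ → ℕ → Matrix (Fin N) (Fin N) ℂ) (m n : ℕ) :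
    Matrix (Fin N) (Fin N) ℂ :=
  K (m + 1) (n + 1)

open scoped ComplexOrder in
/-- The restriction of the kernel `K` to the set of levels `S` is positive definite:
`∑_{a,b} ⟨u_a, K(x_a, x_b) u_b⟩ ≥ 0` for all finite families of levels `x_a ∈ S` and
vectors `u_a ∈ ℂ^N` (`≤` on `ℂ` includes that the sum is real). -/
def IsPosDefKernelOn {N : ℕ} (S : Set ℕ) (K : ℕ → ℕ → Matrix (Fin N) (Fin N) ℂ) : Prop :=
  ∀ (k : ℕ) (x : Fin k → ℕ) (u : Fin k → Fin N → ℂ), (∀ a, x a ∈ S) →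
    (0 : ℂ) ≤ ∑ a, ∑ b, star (u a) ⬝ᵥ (K (x a) (x b)).mulVec (u b)

/-- Kernel order on the levels in `S`: `K ≤ L` there, i.e. `L - K` is positive definite. -/
def KernelLEOn {N : ℕ} (S : Set ℕ) (K L : ℕ → ℕ → Matrix (Fin N) (Fin N) ℂ) : Prop :=
  IsPosDefKernelOn S (L - K)

/-- Asymptotic domination of a sequence of kernels `K_N` by a sequence of kernels `L_N`:
for every `ε > 0` and every `M`, for all large `N`, `K_N ≤ (1 + ε) L_N` on the levels
`0, …, M`. -/
def AsymptoticallyDominated (K L : (N : ℕ) → ℕ → ℕ → Matrix (Fin N) (Fin N) ℂ) : Prop :=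
  ∀ ε : ℝ, 0 < ε → ∀ M : ℕ, ∀ᶠ N in atTop,
    KernelLEOn (Set.Iic M) (K N) (((1 + ε : ℝ) : ℂ) • L N)

/-- The kernel `(m, n) ↦ δ_{mn} τ^m I_N`. -/
def limitKernel (τ : ℝ≥0) (N : ℕ) (m n : ℕ) : Matrix (Fin N) (Fin N) ℂ :=
  if m = n then ((τ : ℂ) ^ m) • (1 : Matrix (Fin N) (Fin N) ℂ) else 0

open scoped Matrix.Norms.L2Operator in
/-- `K_N(m, n) - L_N(m, n) → 0` in operator norm as `N → ∞`, for all levels `m, n`. -/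
def AsymptoticallyEqual (K L : (N : ℕ) → ℕ → ℕ → Matrix (Fin N) (Fin N) ℂ) : Prop :=
  ∀ m n : ℕ, Tendsto (fun N => ‖K N m n - L N m n‖) atTop (𝓝 0)

end GinibreKernel

end

namespace GinibreKernel

/-! ### The complex Gaussian law -/

/-! The law of a Ginibre matrix is invariant under arbitrary phases on the entries and under
simultaneous permutation of rows and columns. A global phase kills `K(m, n)` for `m ≠ n`,
conjugation by diagonal signs kills its off-diagonal entries, and transpositions equate the diagonal
ones. Hence `K(m, n) = δ_{mn} c_m I` (`momentKernel_eq`). A unital linear map fixes such a kernel,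
and the order between such kernels is comparison of the coefficients level by level
(`kernelLEOn_scalarKernel`).

What remains is `c_m → τ^m`. Expand `c_m` over pairs of paths `p, q` from one vertex to a common
endpoint. By phase invariance a pair contributes only if every edge of `q` is an edge of `p`. If `p`
is self-avoiding this forces `q = p`, with contribution `(τ/N)^m`. The other paths number
`O(N^(m-1))`, each with at most `m^m` partners and moments `O(N^(-m))`, so they vanish in the limit
(`abs_normMoment_sub_le`). The exact values `c_0 = 1` and `c_1 = τ` make level zero decide the
threshold. -/

lemma complexGaussian_eq_map (v : ℝ≥0) :
    complexGaussian v = ((gaussianReal 0 (v / 2)).prod (gaussianReal 0 (v / 2))).map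
      Complex.equivRealProdCLM.symm := rfl

instance (v : ℝ≥0) : IsGaussian (complexGaussian v) := by
  rw [complexGaussian_eq_map]
  infer_instance

/-- The dependence on `‖t‖` alone is the source of all the phase invariance below. -/
lemma charFun_complexGaussian (v : ℝ≥0) (t : ℂ) :
    charFun (complexGaussian v) t = Complex.exp (-(v * ‖t‖ ^ 2 / 4 : ℝ)) := by
  have h : ∀ x : ℝ × ℝ, Complex.exp (↑(inner ℝ (Complex.equivRealProdCLM.symm x) t) * Complex.I) =
      Complex.exp (↑(inner ℝ x.1 t.re) * Complex.I) *
        Complex.exp (↑(inner ℝ x.2 t.im) * Complex.I) := by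
    intro x
    rw [← Complex.exp_add, Complex.inner]
    congr 1
    simp [Complex.equivRealProdCLM_symm_apply]
    ring
  rw [complexGaussian_eq_map, charFun_apply, integral_map (by fun_prop) (by fun_prop)]
  simp_rw [h]
  rw [integral_prod_mul (fun x : ℝ => Complex.exp (↑(inner ℝ x t.re) * Complex.I))
    (fun x : ℝ => Complex.exp (↑(inner ℝ x t.im) * Complex.I)), ← charFun_apply, ← charFun_apply,
    charFun_gaussianReal, charFun_gaussianReal, ← Complex.exp_add, ← Complex.normSq_eq_norm_sq,
    Complex.normSq_apply]
  congr 1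
  push_cast
  ring

/-- Multiplication by `c` maps `𝒩_ℂ(0, v)` to `𝒩_ℂ(0, |c|² v)`. -/
lemma map_mul_complexGaussian (v : ℝ≥0) (c : ℂ) :
    (complexGaussian v).map (fun z => c * z) = complexGaussian (‖c‖₊ ^ 2 * v) := by
  have : IsProbabilityMeasure ((complexGaussian v).map (fun z => c * z)) :=
    Measure.isProbabilityMeasure_map (by fun_prop)
  refine Measure.ext_of_charFun (funext fun t => ?_)
  rw [charFun_apply, integral_map (by fun_prop) (by fun_prop)]
  have h : ∀ z : ℂ, inner ℝ (c * z) t = inner ℝ z (star c * t) := by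
    intro z
    simp only [Complex.inner, map_mul, RCLike.star_def]
    congr 1
    ring
  simp_rw [h]
  rw [← charFun_apply, charFun_complexGaussian, charFun_complexGaussian]
  congr 2
  simp
  ring

lemma integrable_norm_pow_complexGaussian (v : ℝ≥0) (k : ℕ) :
    Integrable (fun z : ℂ => ‖z‖ ^ k) (complexGaussian v) :=
  (IsGaussian.memLp_id (complexGaussian v) k (by simp)).integrable_norm_pow'

lemma integral_norm_sq_complexGaussian (v : ℝ≥0) :
    ∫ z, ‖z‖ ^ 2 ∂complexGaussian v = v := by
  have h2 : ∫ x, x ^ 2 ∂gaussianReal 0 (v / 2) = v / 2 := by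
    have h := variance_of_integral_eq_zero (X := id) (μ := gaussianReal 0 (v / 2))
      (by fun_prop) (by simp)
    rw [variance_id_gaussianReal] at h
    simpa using h.symm
  have hi : Integrable (fun x : ℝ => x ^ 2) (gaussianReal 0 (v / 2)) :=
    (memLp_id_gaussianReal 2).integrable_sq
  have h : ∀ x : ℝ × ℝ, ‖Complex.equivRealProdCLM.symm x‖ ^ 2 = x.1 ^ 2 + x.2 ^ 2 := by
    intro x
    rw [← Complex.normSq_eq_norm_sq, Complex.normSq_apply]
    simp [Complex.equivRealProdCLM_symm_apply]
    ring
  rw [complexGaussian_eq_map, integral_map (by fun_prop) (by fun_prop)]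
  simp_rw [h]
  rw [integral_add (hi.comp_fst _) (hi.comp_snd _), integral_fun_fst (fun x : ℝ => x ^ 2),
    integral_fun_snd (fun x : ℝ => x ^ 2), h2]
  simp

/-- The law is the image of the standard one under scaling by `√v`. This isolates `v ^ m`, so the
remaining constant does not depend on the matrix size. -/
lemma integral_norm_pow_complexGaussian (v : ℝ≥0) (m : ℕ) :
    ∫ z, ‖z‖ ^ (2 * m) ∂complexGaussian v = v ^ m * ∫ z, ‖z‖ ^ (2 * m) ∂complexGaussian 1 := by
  have h : complexGaussian v = (complexGaussian 1).map (fun z => (√(v : ℝ) : ℂ) * z) := by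
    rw [map_mul_complexGaussian]
    congr 1
    ext
    simp [abs_of_nonneg]
  rw [h, integral_map (by fun_prop) (by fun_prop), ← integral_const_mul]
  congr 1 with z
  rw [norm_mul, mul_pow, pow_mul ‖(√(v : ℝ) : ℂ)‖]
  simp

/-! ### Ginibre matrices -/

variable {Ω : Type*} [MeasurableSpace Ω] {P : Measure Ω} {N : ℕ}
  {A : Ω → Matrix (Fin N) (Fin N) ℂ} {v : ℝ≥0}

namespace IsComplexGinibre

/-- Expectations of functions of a Ginibre matrix depend only on its size and variance. -/
lemma integral_eq {Ω' : Type*} [MeasurableSpace Ω'] {P' : Measure Ω'}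
    [IsProbabilityMeasure P] [IsProbabilityMeasure P']
    {A' : Ω' → Matrix (Fin N) (Fin N) ℂ} (hA : IsComplexGinibre P A v)
    (hA' : IsComplexGinibre P' A' v) {F : Matrix (Fin N) (Fin N) ℂ → ℂ} (hF : Continuous F) :
    ∫ ω, F (A ω) ∂P = ∫ ω, F (A' ω) ∂P' := by
  have hm : ∀ p : Fin N × Fin N, AEMeasurable (fun ω => A ω p.1 p.2) P :=
    fun p => (hA.law p.1 p.2).aemeasurable
  have hm' : ∀ p : Fin N × Fin N, AEMeasurable (fun ω => A' ω p.1 p.2) P' :=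
    fun p => (hA'.law p.1 p.2).aemeasurable
  have h := (iIndepFun_iff_map_fun_eq_pi_map hm).1 hA.indep
  have h' := (iIndepFun_iff_map_fun_eq_pi_map hm').1 hA'.indep
  simp_rw [(hA.law _ _).map_eq] at h
  simp_rw [(hA'.law _ _).map_eq] at h'
  have hG : Continuous fun x : Fin N × Fin N → ℂ => F (Matrix.of fun i j => x (i, j)) :=
    hF.comp (continuous_matrix fun i j => continuous_apply (i, j))
  have e := integral_map (aemeasurable_pi_lambda _ hm) hG.aestronglyMeasurable
  have e' := integral_map (aemeasurable_pi_lambda _ hm') hG.aestronglyMeasurable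
  rw [h] at e
  rw [h'] at e'
  exact e.symm.trans e'

/-- Multiplying the entries of a Ginibre matrix by phases gives a Ginibre matrix. -/
lemma phase_mul (hA : IsComplexGinibre P A v) (w : Fin N → Fin N → ℂ)
    (hw : ∀ i j, ‖w i j‖ = 1) :
    IsComplexGinibre P (fun ω => Matrix.of fun i j => w i j * A ω i j) v where
  indep := hA.indep.comp (fun p z => w p.1 p.2 * z) fun p => by fun_prop
  law i j := by
    refine HasLaw.comp (Y := fun z => w i j * z) ⟨by fun_prop, ?_⟩ (hA.law i j)
    rw [map_mul_complexGaussian]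
    congr 1
    ext
    simp [hw]

lemma submatrix_perm (hA : IsComplexGinibre P A v) (σ : Equiv.Perm (Fin N)) :
    IsComplexGinibre P (fun ω => (A ω).submatrix σ σ) v where
  indep := hA.indep.precomp (g := Prod.map σ σ) (σ.injective.prodMap σ.injective)
  law i j := hA.law (σ i) (σ j)

lemma integrable_norm_pow (hA : IsComplexGinibre P A v) (i j : Fin N) (k : ℕ) :
    Integrable (fun ω => ‖A ω i j‖ ^ k) P := by
  have h := integrable_norm_pow_complexGaussian v k
  rw [← (hA.law i j).map_eq] at h
  exact (integrable_map_measure (by fun_prop) (hA.law i j).aemeasurable).1 h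

lemma integral_norm_pow (hA : IsComplexGinibre P A v) (i j : Fin N) (k : ℕ) :
    ∫ ω, ‖A ω i j‖ ^ k ∂P = ∫ z, ‖z‖ ^ k ∂complexGaussian v :=
  (hA.law i j).integral_comp (f := fun z => ‖z‖ ^ k) (by fun_prop)

end IsComplexGinibre

/-! ### Expansion of matrix powers over paths -/

section Paths

variable {N : ℕ}

/-- The sequence of vertices `i, p 0, …, p (m - 1)` of a path started at `i`. -/
def vertexSeq (i : Fin N) {m : ℕ} (p : Fin m → Fin N) : Fin (m + 1) → Fin N := Fin.cons i p

/-- The `k`-th edge of the path `p` started at `i`. -/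
def pathEdge (i : Fin N) {m : ℕ} (p : Fin m → Fin N) (k : Fin m) : Fin N × Fin N :=
  (vertexSeq i p k.castSucc, vertexSeq i p k.succ)

/-- The product of the entries of `M` along the path `p` started at `i`. -/
def pathWeight (M : Matrix (Fin N) (Fin N) ℂ) (i : Fin N) {m : ℕ} (p : Fin m → Fin N) : ℂ :=
  ∏ k, M (pathEdge i p k).1 (pathEdge i p k).2

lemma pow_apply_eq_sum (M : Matrix (Fin N) (Fin N) ℂ) (m : ℕ) (i j : Fin N) :
    (M ^ m) i j = ∑ p : Fin m → Fin N,
      if vertexSeq i p (Fin.last m) = j then pathWeight M i p else 0 := by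
  induction m generalizing i with
  | zero => simp [Matrix.one_apply, vertexSeq, pathWeight]
  | succ m ih =>
    rw [pow_succ', Matrix.mul_apply, ← (Fin.consEquiv fun _ : Fin (m + 1) => Fin N).sum_comp,
      Fintype.sum_prod_type]
    refine Finset.sum_congr rfl fun k _ => ?_
    rw [ih, Finset.mul_sum]
    refine Finset.sum_congr rfl fun p _ => ?_
    rw [mul_ite, mul_zero, pathWeight, pathWeight, Fin.prod_univ_succ]
    rfl

lemma pow_mul_conjTranspose_pow_apply (M : Matrix (Fin N) (Fin N) ℂ) (m n : ℕ) (i j : Fin N) :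
    (M ^ m * (M ^ n).conjTranspose) i j = ∑ p : Fin m → Fin N, ∑ q : Fin n → Fin N,
      if vertexSeq i p (Fin.last m) = vertexSeq j q (Fin.last n) then
        pathWeight M i p * star (pathWeight M j q) else 0 := by
  simp_rw [Matrix.mul_apply, Matrix.conjTranspose_apply, pow_apply_eq_sum, star_sum,
    Finset.sum_mul_sum]
  rw [Finset.sum_comm]
  refine Finset.sum_congr rfl fun p _ => ?_
  rw [Finset.sum_comm]
  refine Finset.sum_congr rfl fun q _ => ?_
  rw [Finset.sum_eq_single (vertexSeq i p (Fin.last m)) (by simp +contextual [eq_comm]) (by simp)]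
  by_cases h : vertexSeq i p (Fin.last m) = vertexSeq j q (Fin.last n) <;> simp [h, eq_comm]

lemma norm_pathWeight (M : Matrix (Fin N) (Fin N) ℂ) (i : Fin N) {m : ℕ} (p : Fin m → Fin N) :
    ‖pathWeight M i p‖ = ∏ k, ‖M (pathEdge i p k).1 (pathEdge i p k).2‖ := norm_prod _ _

lemma pathWeight_phase (M w : Matrix (Fin N) (Fin N) ℂ) (i : Fin N) {m : ℕ} (p : Fin m → Fin N) :
    pathWeight (Matrix.of fun i j => w i j * M i j) i p = pathWeight w i p * pathWeight M i p := by
  simp [pathWeight, Finset.prod_mul_distrib]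

@[fun_prop]
lemma continuous_pathWeight (i : Fin N) {m : ℕ} (p : Fin m → Fin N) :
    Continuous fun M : Matrix (Fin N) (Fin N) ℂ => pathWeight M i p := by
  unfold pathWeight
  fun_prop

/-- A path all of whose edges lie on a self-avoiding path with the same start is that path. -/
lemma eq_of_pathEdge_mem {i : Fin N} {m : ℕ} {p q : Fin m → Fin N}
    (hp : Function.Injective (vertexSeq i p)) (h : ∀ k, ∃ l, pathEdge i q k = pathEdge i p l) :
    q = p := by
  have key : ∀ k : Fin (m + 1), vertexSeq i q k = vertexSeq i p k := by
    intro k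
    induction k using Fin.induction with
    | zero => rfl
    | succ k ih =>
      obtain ⟨l, hl⟩ := h k
      obtain ⟨h1, h2⟩ := Prod.ext_iff.1 hl
      simp only [pathEdge] at h1 h2
      rw [ih] at h1
      -- By `h1` the edge `l` of `p` leaves its `k`-th vertex; self-avoidance leaves only `l = k`.
      rw [h2, Fin.castSucc_injective _ (hp h1)]
  exact funext fun k => key k.succ

/-- Initial vertices already separate the edges. Entries along a self-avoiding path are therefore
distinct, hence independent. -/
lemma pathEdge_injective {i : Fin N} {m : ℕ} {p : Fin m → Fin N}
    (hp : Function.Injective (vertexSeq i p)) : Function.Injective (pathEdge i p) :=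
  fun _ _ h => Fin.castSucc_injective _ (hp (Prod.ext_iff.1 h).1)

/-- There are at most `m ^ m` paths of length `m` all of whose vertices lie on a given path. -/
lemma card_pathEdge_mem_le (i : Fin N) {m : ℕ} (p : Fin m → Fin N) :
    Fintype.card {q : Fin m → Fin N // ∀ k, ∃ l, pathEdge i q k = pathEdge i p l} ≤ m ^ m := by
  -- The head of each edge of `q` is the head of some edge of `p`, so a map of positions `g`
  -- determines `q`.
  have h : ∀ q : {q : Fin m → Fin N // ∀ k, ∃ l, pathEdge i q k = pathEdge i p l},
      ∃ g : Fin m → Fin m, q.1 = p ∘ g := by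
    rintro ⟨q, hq⟩
    have hq' := hq
    choose g hg using hq'
    exact ⟨g, funext fun k => (Prod.ext_iff.1 (hg k)).2⟩
  choose g hg using h
  have hinj : Function.Injective g := fun q q' e => Subtype.ext (by rw [hg, hg, e])
  simpa using Fintype.card_le_of_injective g hinj

/-- Lower bound for the number of self-avoiding paths started at `i`. -/
lemma pow_le_card_injective (i : Fin N) (m : ℕ) :
    (N - m) ^ m ≤ Fintype.card {p : Fin m → Fin N // Function.Injective (vertexSeq i p)} := by
  have hN : 1 ≤ N := i.pos
  have h1 : (N - m) ^ m ≤ (N - 1).descFactorial m := by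
    simpa [Nat.sub_add_cancel hN] using Nat.pow_sub_le_descFactorial (N - 1) m
  -- Embeddings into the `N - 1` vertices other than `i` give self-avoiding paths.
  have h2 : Fintype.card (Fin m ↪ {x : Fin N // x ≠ i}) = (N - 1).descFactorial m := by
    rw [Fintype.card_embedding_eq]
    simp [Fintype.card_subtype_compl]
  rw [← h2] at h1
  refine h1.trans (Fintype.card_le_of_injective
    (fun f => ⟨fun k => (f k).1, ?_⟩) fun f g h => ?_)
  · exact Fin.cons_injective_iff.2 ⟨by rintro ⟨k, hk⟩; exact (f k).2 hk,
      fun a b hab => f.injective (Subtype.ext hab)⟩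
  · ext k
    exact congrArg Fin.val (congrFun (Subtype.ext_iff.1 h) k)

end Paths

/-! ### Moments along paths -/

/-- Every factor is at most the largest one, whose power is among the summands. Mixed moments are
thus bounded by single-entry moments, however often an edge repeats. -/
lemma prod_le_sum_pow_card {ι : Type*} [Fintype ι] [Nonempty ι] (x : ι → ℝ) (hx : ∀ i, 0 ≤ x i) :
    ∏ i, x i ≤ ∑ i, x i ^ Fintype.card ι := by
  obtain ⟨i, -, hi⟩ := Finset.exists_max_image Finset.univ x Finset.univ_nonempty
  calc ∏ j, x j ≤ ∏ _j : ι, x i := Finset.prod_le_prod (fun j _ => hx j) hi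
    _ = x i ^ Fintype.card ι := by simp
    _ ≤ _ := Finset.single_le_sum (f := fun j => x j ^ Fintype.card ι)
      (fun j _ => pow_nonneg (hx j) _) (Finset.mem_univ i)

/-- The witness is `exp(iπ / (m - n))`. The value `-1` turns an invariance into `x = -x`. -/
lemma exists_norm_one_pow_mul_star_pow_ne_one {m n : ℕ} (h : m ≠ n) :
    ∃ c : ℂ, ‖c‖ = 1 ∧ c ^ m * star c ^ n = -1 := by
  have h' : (m : ℂ) - n ≠ 0 := sub_ne_zero.2 (by exact_mod_cast h)
  refine ⟨Complex.exp ((Real.pi / (m - n) : ℝ) * Complex.I), Complex.norm_exp_ofReal_mul_I _, ?_⟩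
  rw [RCLike.star_def, ← Complex.exp_conj, ← Complex.exp_nat_mul, ← Complex.exp_nat_mul,
    ← Complex.exp_add, ← Complex.exp_pi_mul_I]
  congr 1
  simp only [map_mul, Complex.conj_ofReal, Complex.conj_I]
  push_cast
  field_simp
  ring

variable {Ω : Type*} [MeasurableSpace Ω] {P : Measure Ω} {N : ℕ}
  {A : Ω → Matrix (Fin N) (Fin N) ℂ} {v : ℝ≥0}

/-- The joint moment of a Ginibre matrix along two paths. -/
noncomputable def pathMoment (P : Measure Ω) (A : Ω → Matrix (Fin N) (Fin N) ℂ) (i j : Fin N) {m n : ℕ}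
    (p : Fin m → Fin N) (q : Fin n → Fin N) : ℂ :=
  ∫ ω, pathWeight (A ω) i p * star (pathWeight (A ω) j q) ∂P

namespace IsComplexGinibre

lemma aemeasurable (hA : IsComplexGinibre P A v) (i j : Fin N) :
    AEMeasurable (fun ω => A ω i j) P :=
  (hA.law i j).aemeasurable

lemma integrable_pathWeight [IsProbabilityMeasure P] (hA : IsComplexGinibre P A v) (i j : Fin N)
    {m n : ℕ} (p : Fin m → Fin N) (q : Fin n → Fin N) :
    Integrable (fun ω => pathWeight (A ω) i p * star (pathWeight (A ω) j q)) P := by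
  have hm : AEStronglyMeasurable
      (fun ω => pathWeight (A ω) i p * star (pathWeight (A ω) j q)) P := by
    have h1 : AEMeasurable (fun ω => pathWeight (A ω) i p) P :=
      Finset.aemeasurable_fun_prod _ fun k _ => hA.aemeasurable _ _
    have h2 : AEMeasurable (fun ω => pathWeight (A ω) j q) P :=
      Finset.aemeasurable_fun_prod _ fun k _ => hA.aemeasurable _ _
    exact (h1.mul (continuous_star.measurable.comp_aemeasurable h2)).aestronglyMeasurable
  let e : Fin m ⊕ Fin n → Fin N × Fin N := Sum.elim (pathEdge i p) (pathEdge j q)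
  have he : ∀ ω, ‖pathWeight (A ω) i p * star (pathWeight (A ω) j q)‖ =
      ∏ k, ‖A ω (e k).1 (e k).2‖ := by
    intro ω
    rw [norm_mul, norm_star, norm_pathWeight, norm_pathWeight, Fintype.prod_sum_type]
    rfl
  -- Two paths of length zero have the constant weight 1 and leave no factor to maximize.
  rcases isEmpty_or_nonempty (Fin m ⊕ Fin n) with h0 | h0
  · refine (integrable_const (1 : ℝ)).mono' hm (.of_forall fun ω => ?_)
    rw [he]
    simp
  · refine (integrable_finsetSum Finset.univ fun k _ => hA.integrable_norm_pow (e k).1 (e k).2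
      (Fintype.card (Fin m ⊕ Fin n))).mono' hm (.of_forall fun ω => ?_)
    rw [he]
    exact prod_le_sum_pow_card _ fun k => norm_nonneg _

/-- Each of the `2 * m` edges contributes one absolute moment of order `2 * m`. The extra `1` keeps
the bound true at `m = 0`. -/
lemma norm_pathMoment_le [IsProbabilityMeasure P] (hA : IsComplexGinibre P A v) (i j : Fin N)
    {m : ℕ} (p q : Fin m → Fin N) :
    ‖pathMoment P A i j p q‖ ≤
      (2 * m + 1) * (∫ z, ‖z‖ ^ (2 * m) ∂complexGaussian 1) * v ^ m := by
  rcases Nat.eq_zero_or_pos m with rfl | hm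
  · simp [pathMoment, pathWeight]
  have : Nonempty (Fin m ⊕ Fin m) := ⟨.inl ⟨0, hm⟩⟩
  let e : Fin m ⊕ Fin m → Fin N × Fin N := Sum.elim (pathEdge i p) (pathEdge j q)
  have he : ∀ ω, ‖pathWeight (A ω) i p * star (pathWeight (A ω) j q)‖ ≤
      ∑ k, ‖A ω (e k).1 (e k).2‖ ^ (2 * m) := by
    intro ω
    have h := prod_le_sum_pow_card (fun k => ‖A ω (e k).1 (e k).2‖) fun k => norm_nonneg _
    rw [Fintype.card_sum, Fintype.card_fin, ← two_mul] at h
    refine le_trans (le_of_eq ?_) h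
    rw [norm_mul, norm_star, norm_pathWeight, norm_pathWeight, Fintype.prod_sum_type]
    rfl
  have hi := fun k (_ : k ∈ Finset.univ) => hA.integrable_norm_pow (e k).1 (e k).2 (2 * m)
  refine (norm_integral_le_of_norm_le (integrable_finsetSum _ hi) (.of_forall he)).trans ?_
  rw [integral_finsetSum _ hi]
  simp_rw [hA.integral_norm_pow, integral_norm_pow_complexGaussian v m]
  simp only [Finset.sum_const, Finset.card_univ, Fintype.card_sum, Fintype.card_fin, nsmul_eq_mul]
  have h0 : 0 ≤ ∫ z, ‖z‖ ^ (2 * m) ∂complexGaussian 1 := integral_nonneg fun z => by positivity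
  have h1 : 0 ≤ (v : ℝ) ^ m * ∫ z, ‖z‖ ^ (2 * m) ∂complexGaussian 1 := by positivity
  push_cast
  linarith

lemma pathMoment_phase [IsProbabilityMeasure P] (hA : IsComplexGinibre P A v) (i j : Fin N)
    {m n : ℕ} (p : Fin m → Fin N) (q : Fin n → Fin N) (w : Matrix (Fin N) (Fin N) ℂ)
    (hw : ∀ i j, ‖w i j‖ = 1) :
    pathMoment P A i j p q =
      pathWeight w i p * star (pathWeight w j q) * pathMoment P A i j p q := by
  have hF : Continuous fun M : Matrix (Fin N) (Fin N) ℂ =>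
    pathWeight M i p * star (pathWeight M j q) := by fun_prop
  have h := hA.integral_eq (hA.phase_mul w hw) hF
  simp_rw [pathWeight_phase] at h
  rw [pathMoment, ← integral_const_mul]
  refine h.trans (integral_congr_ae (.of_forall fun ω => ?_))
  simp only [star_mul']
  ring

/-- The joint moment vanishes if the second path uses an edge that the first one avoids. -/
lemma pathMoment_eq_zero [IsProbabilityMeasure P] (hA : IsComplexGinibre P A v) (i j : Fin N)
    {m n : ℕ} (p : Fin m → Fin N) (q : Fin n → Fin N)
    (h : ¬ ∀ k, ∃ l, pathEdge j q k = pathEdge i p l) : pathMoment P A i j p q = 0 := by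
  push Not at h
  obtain ⟨k, hk⟩ := h
  -- `r` counts the passages of `q` through the edge missed by `p`. A phase placed on that edge
  -- alone leaves the weight of `p` unchanged and multiplies the conjugate weight of `q` by `star c
  -- ^ r = -1`.
  set r := (Finset.univ.filter fun l => pathEdge j q l = pathEdge j q k).card with hr
  have hr0 : 0 ≠ r := (Finset.card_pos.2 ⟨k, by simp⟩).ne
  obtain ⟨c, hc, hc'⟩ := exists_norm_one_pow_mul_star_pow_ne_one hr0
  have e := hA.pathMoment_phase i j p q
    (Matrix.of fun a b => if (a, b) = pathEdge j q k then c else 1)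
    (fun a b => by simp only [Matrix.of_apply]; split_ifs <;> simp [hc])
  have h1 : pathWeight (Matrix.of fun a b => if (a, b) = pathEdge j q k then c else 1) i p = 1 :=
    Finset.prod_eq_one fun l _ => if_neg (hk l).symm
  have h2 : pathWeight (Matrix.of fun a b => if (a, b) = pathEdge j q k then c else 1) j q =
      c ^ r := by
    simp [pathWeight, Finset.prod_ite, hr]
  rw [pow_zero, one_mul] at hc'
  rw [h1, h2, one_mul, star_pow, hc'] at e
  linear_combination e / 2

lemma pathMoment_self [IsProbabilityMeasure P] (hA : IsComplexGinibre P A v) (i : Fin N) {m : ℕ}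
    (p : Fin m → Fin N) (hp : Function.Injective (vertexSeq i p)) :
    pathMoment P A i i p p = (v : ℂ) ^ m := by
  have h : ∀ ω, pathWeight (A ω) i p * star (pathWeight (A ω) i p) =
      ((∏ k, ‖A ω (pathEdge i p k).1 (pathEdge i p k).2‖ ^ 2 : ℝ) : ℂ) := by
    intro ω
    rw [RCLike.star_def, Complex.mul_conj, Complex.normSq_eq_norm_sq, norm_pathWeight,
      Finset.prod_pow]
  have hind := (hA.indep.precomp (pathEdge_injective hp)).comp (fun _ z => ‖z‖ ^ 2)
    fun _ => by fun_prop
  simp_rw [pathMoment, h]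
  rw [integral_complex_ofReal]
  have e := hind.integral_fun_prod_eq_prod_integral fun k =>
    (hA.integrable_norm_pow (pathEdge i p k).1 (pathEdge i p k).2 2).aestronglyMeasurable
  refine (congrArg _ e).trans ?_
  have e2 : ∀ k : Fin m, ∫ ω, ‖A ω (pathEdge i p k).1 (pathEdge i p k).2‖ ^ 2 ∂P = v := fun k => by
    rw [hA.integral_norm_pow, integral_norm_sq_complexGaussian]
  exact (congrArg _ (Finset.prod_congr rfl fun k _ => e2 k)).trans (by simp)

end IsComplexGinibre

/-! ### The moment kernel of a Ginibre matrix -/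

/-- The diagonal moments are real: they are expectations of squared norms. -/
lemma momentKernel_diag_im {Ω : Type*} [MeasurableSpace Ω] (P : Measure Ω) {N : ℕ}
    (A : Ω → Matrix (Fin N) (Fin N) ℂ) (m : ℕ) (i : Fin N) :
    (momentKernel P A m m i i).im = 0 := by
  have h : ∀ ω, (A ω ^ m * (A ω ^ m).conjTranspose) i i =
      ((∑ j, Complex.normSq ((A ω ^ m) i j) : ℝ) : ℂ) := by
    intro ω
    simp [Matrix.mul_apply, Complex.mul_conj, -Matrix.conjTranspose_pow]
  simp only [momentKernel, Matrix.of_apply]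
  simp_rw [h]
  rw [integral_complex_ofReal, Complex.ofReal_im]

section MomentKernel

variable {Ω : Type*} [MeasurableSpace Ω] {P : Measure Ω} [IsProbabilityMeasure P] {N : ℕ}
  {A : Ω → Matrix (Fin N) (Fin N) ℂ} {v : ℝ≥0}

namespace IsComplexGinibre

lemma integrable_pow_mul_conjTranspose_pow (hA : IsComplexGinibre P A v) (m n : ℕ)
    (i j : Fin N) : Integrable (fun ω => (A ω ^ m * (A ω ^ n).conjTranspose) i j) P := by
  simp_rw [pow_mul_conjTranspose_pow_apply]
  refine integrable_finsetSum _ fun p _ => integrable_finsetSum _ fun q _ => ?_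
  split_ifs
  · exact hA.integrable_pathWeight i j p q
  · exact integrable_zero _ _ _

lemma momentKernel_apply_eq_sum (hA : IsComplexGinibre P A v) (m n : ℕ) (i j : Fin N) :
    momentKernel P A m n i j = ∑ p : Fin m → Fin N, ∑ q : Fin n → Fin N,
      if vertexSeq i p (Fin.last m) = vertexSeq j q (Fin.last n) then
        pathMoment P A i j p q else 0 := by
  have hi : ∀ (p : Fin m → Fin N) (q : Fin n → Fin N), Integrable (fun ω =>
      if vertexSeq i p (Fin.last m) = vertexSeq j q (Fin.last n) then
        pathWeight (A ω) i p * star (pathWeight (A ω) j q) else 0) P := by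
    intro p q
    split_ifs
    · exact hA.integrable_pathWeight i j p q
    · exact integrable_zero _ _ _
  simp_rw [momentKernel, Matrix.of_apply, pow_mul_conjTranspose_pow_apply]
  rw [integral_finsetSum _ fun p _ => integrable_finsetSum _ fun q _ => hi p q]
  refine Finset.sum_congr rfl fun p _ => ?_
  rw [integral_finsetSum _ fun q _ => hi p q]
  refine Finset.sum_congr rfl fun q _ => ?_
  split_ifs
  · rfl
  · simp

lemma continuous_pow_mul_conjTranspose_pow (m n : ℕ) (i j : Fin N) :
    Continuous fun M : Matrix (Fin N) (Fin N) ℂ => (M ^ m * (M ^ n).conjTranspose) i j := by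
  fun_prop

/-- Replacing `A` by `c • A` with `‖c‖ = 1` preserves the law and multiplies the integrand by `c ^ m
* star c ^ n`, chosen to be `-1`. -/
lemma momentKernel_of_ne (hA : IsComplexGinibre P A v) {m n : ℕ} (h : m ≠ n) :
    momentKernel P A m n = 0 := by
  ext i j
  obtain ⟨c, hc, hc'⟩ := exists_norm_one_pow_mul_star_pow_ne_one h
  have e := hA.integral_eq (hA.phase_mul (fun _ _ => c) fun _ _ => hc)
    (continuous_pow_mul_conjTranspose_pow m n i j)
  have h1 : ∀ M : Matrix (Fin N) (Fin N) ℂ, ((Matrix.of fun i j => c * M i j) ^ m *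
      ((Matrix.of fun i j => c * M i j) ^ n).conjTranspose) i j =
        -(M ^ m * (M ^ n).conjTranspose) i j := by
    intro M
    have h2 : (Matrix.of fun i j => c * M i j) = c • M := rfl
    rw [h2, smul_pow, smul_pow, Matrix.conjTranspose_smul, star_pow, Matrix.smul_mul,
      Matrix.mul_smul, smul_smul, hc', neg_one_smul, Matrix.neg_apply]
  simp_rw [h1, integral_neg] at e
  simp only [momentKernel, Matrix.of_apply, Matrix.zero_apply]
  linear_combination e / 2

/-- Conjugating `A` by the diagonal sign matrix with `-1` only at `i` preserves the law and flips
the sign of the `(i, j)` entry. -/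
lemma momentKernel_apply_of_ne (hA : IsComplexGinibre P A v) (m n : ℕ) {i j : Fin N}
    (h : i ≠ j) : momentKernel P A m n i j = 0 := by
  let d : Fin N → ℂ := fun k => if k = i then -1 else 1
  have hd : ∀ k, d k * d k = 1 := fun k => by simp only [d]; split_ifs <;> simp
  have hd' : ∀ k, star (d k) = d k := fun k => by simp only [d]; split_ifs <;> simp
  have hdn : ∀ k, ‖d k‖ = 1 := fun k => by simp only [d]; split_ifs <;> simp
  have e := hA.integral_eq (hA.phase_mul (fun a b => d a * d b) fun a b => by simp [hdn])
    (continuous_pow_mul_conjTranspose_pow m n i j)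
  have hDD : Matrix.diagonal d * Matrix.diagonal d = 1 := by
    rw [Matrix.diagonal_mul_diagonal, ← Matrix.diagonal_one]
    exact congrArg _ (funext hd)
  have hDs : (Matrix.diagonal d).conjTranspose = Matrix.diagonal d := by
    rw [Matrix.diagonal_conjTranspose]
    exact congrArg _ (funext hd')
  have hpow : ∀ (M : Matrix (Fin N) (Fin N) ℂ) (k : ℕ),
      (Matrix.of fun a b => d a * d b * M a b) ^ k =
        Matrix.diagonal d * M ^ k * Matrix.diagonal d := by
    intro M k
    have h0 : (Matrix.of fun a b => d a * d b * M a b) =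
        Matrix.diagonal d * M * Matrix.diagonal d := by
      ext a b
      rw [Matrix.mul_diagonal, Matrix.diagonal_mul, Matrix.of_apply]
      ring
    induction k with
    | zero => simp [hDD]
    | succ k ih =>
      rw [pow_succ, ih, h0, pow_succ]
      calc Matrix.diagonal d * M ^ k * Matrix.diagonal d *
            (Matrix.diagonal d * M * Matrix.diagonal d)
          = Matrix.diagonal d * M ^ k * (Matrix.diagonal d * Matrix.diagonal d) * M *
            Matrix.diagonal d := by simp only [Matrix.mul_assoc]
        _ = _ := by rw [hDD]; simp only [Matrix.mul_assoc, Matrix.mul_one]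
  have h1 : ∀ M : Matrix (Fin N) (Fin N) ℂ, ((Matrix.of fun a b => d a * d b * M a b) ^ m *
      ((Matrix.of fun a b => d a * d b * M a b) ^ n).conjTranspose) i j =
        -(M ^ m * (M ^ n).conjTranspose) i j := by
    intro M
    have h2 : (Matrix.of fun a b => d a * d b * M a b) ^ m *
        ((Matrix.of fun a b => d a * d b * M a b) ^ n).conjTranspose =
        Matrix.diagonal d * (M ^ m * (M ^ n).conjTranspose) * Matrix.diagonal d := by
      rw [hpow, hpow, Matrix.conjTranspose_mul, Matrix.conjTranspose_mul, hDs]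
      calc Matrix.diagonal d * M ^ m * Matrix.diagonal d *
            (Matrix.diagonal d * ((M ^ n).conjTranspose * Matrix.diagonal d))
          = Matrix.diagonal d * M ^ m * (Matrix.diagonal d * Matrix.diagonal d) *
            (M ^ n).conjTranspose * Matrix.diagonal d := by simp only [Matrix.mul_assoc]
        _ = _ := by rw [hDD]; simp only [Matrix.mul_assoc, Matrix.mul_one]
    rw [h2, Matrix.mul_diagonal, Matrix.diagonal_mul]
    simp [d, h.symm]
  simp_rw [h1, integral_neg] at e
  simp only [momentKernel, Matrix.of_apply]
  linear_combination e / 2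

/-- Swapping the indices `i` and `j` in both rows and columns preserves the law. -/
lemma momentKernel_diag_eq (hA : IsComplexGinibre P A v) (m n : ℕ) (i j : Fin N) :
    momentKernel P A m n i i = momentKernel P A m n j j := by
  have e := hA.integral_eq (hA.submatrix_perm (Equiv.swap i j))
    (continuous_pow_mul_conjTranspose_pow m n i i)
  have hpow : ∀ (M : Matrix (Fin N) (Fin N) ℂ) (σ : Equiv.Perm (Fin N)) (k : ℕ),
      (M.submatrix σ σ) ^ k = (M ^ k).submatrix σ σ := fun M σ k =>
    (map_pow (Matrix.reindexAlgEquiv ℂ ℂ σ.symm) M k).symm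
  simp_rw [hpow, Matrix.conjTranspose_submatrix, Matrix.submatrix_mul_equiv,
    Matrix.submatrix_apply, Equiv.swap_apply_left] at e
  exact e

/-- The moment kernel of a Ginibre matrix is diagonal in the levels and scalar at each level. -/
lemma momentKernel_eq (hA : IsComplexGinibre P A v) (m n : ℕ) :
    momentKernel P A m n =
      if m = n then (normMoment P A m : ℂ) • (1 : Matrix (Fin N) (Fin N) ℂ) else 0 := by
  split_ifs with h
  · subst h
    ext i j
    rcases eq_or_ne i j with rfl | hij
    · have hN : (N : ℝ) ≠ 0 := by exact_mod_cast i.pos.ne'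
      have hr : normMoment P A m = (momentKernel P A m m i i).re := by
        rw [normMoment, Matrix.trace, Complex.re_sum]
        simp only [Matrix.diag_apply]
        simp_rw [fun k => hA.momentKernel_diag_eq m m k i]
        simp [hN]
      rw [hr, Matrix.smul_apply, Matrix.one_apply_eq, smul_eq_mul, mul_one]
      exact Complex.ext rfl (momentKernel_diag_im P A m i)
    · rw [hA.momentKernel_apply_of_ne _ _ hij, Matrix.smul_apply, Matrix.one_apply_ne hij,
        smul_zero]
  · exact hA.momentKernel_of_ne h

lemma ofReal_normMoment (hA : IsComplexGinibre P A v) (m : ℕ) (i : Fin N) :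
    (normMoment P A m : ℂ) = momentKernel P A m m i i := by
  rw [hA.momentKernel_eq]
  simp

lemma normMoment_zero (hA : IsComplexGinibre P A v) (hN : 1 ≤ N) : normMoment P A 0 = 1 := by
  have h := hA.ofReal_normMoment 0 ⟨0, hN⟩
  simp only [momentKernel, Matrix.of_apply, pow_zero, Matrix.conjTranspose_one, mul_one,
    Matrix.one_apply_eq, integral_const, probReal_univ, one_smul] at h
  exact_mod_cast h

open scoped Classical in
/-- The deviation of the moments from `(N v) ^ m` is controlled by the number of paths which are
not self-avoiding. -/
lemma abs_normMoment_sub_le (hA : IsComplexGinibre P A v) (hN : 1 ≤ N) (m : ℕ) :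
    |normMoment P A m - N ^ m * v ^ m| ≤
      ((N : ℝ) ^ m - ((N - m : ℕ) : ℝ) ^ m) * ((m ^ m : ℕ) *
        ((2 * m + 1) * (∫ z, ‖z‖ ^ (2 * m) ∂complexGaussian 1) * v ^ m) + v ^ m) := by
  set i : Fin N := ⟨0, hN⟩
  set C : ℝ := (2 * m + 1) * (∫ z, ‖z‖ ^ (2 * m) ∂complexGaussian 1) * v ^ m
  have hC : 0 ≤ C := (norm_nonneg _).trans
    (hA.norm_pathMoment_le i i (fun _ => i) fun _ : Fin m => i)
  -- `T p` collects the contributions of all partners `q` of `p`.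
  let T : (Fin m → Fin N) → ℂ := fun p => ∑ q : Fin m → Fin N,
    if vertexSeq i p (Fin.last m) = vertexSeq i q (Fin.last m) then pathMoment P A i i p q else 0
  have hgood : ∀ p, Function.Injective (vertexSeq i p) → T p = (v : ℂ) ^ m := by
    intro p hp
    simp only [T]
    rw [Finset.sum_eq_single p _ (by simp), if_pos rfl, hA.pathMoment_self i p hp]
    intro q _ hq
    rw [hA.pathMoment_eq_zero i i p q fun h => hq (eq_of_pathEdge_mem hp h), ite_self]
  have hbad : ∀ p, ‖T p‖ ≤ (m ^ m : ℕ) * C := by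
    intro p
    calc ‖T p‖ ≤ ∑ q : Fin m → Fin N,
          if ∀ k, ∃ l, pathEdge i q k = pathEdge i p l then C else 0 := by
          refine norm_sum_le_of_le _ fun q _ => ?_
          split_ifs with h1 h2 h2
          · exact hA.norm_pathMoment_le i i p q
          · rw [hA.pathMoment_eq_zero i i p q h2, norm_zero]
          · simpa using hC
          · simp
      _ = Fintype.card {q : Fin m → Fin N // ∀ k, ∃ l, pathEdge i q k = pathEdge i p l} * C := by
          rw [← Finset.sum_filter, Finset.sum_const, nsmul_eq_mul, Fintype.card_subtype]
      _ ≤ _ := by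
          gcongr
          exact_mod_cast card_pathEdge_mem_le i p
  -- There are `N ^ m` paths in all, so each is charged `v ^ m`; self-avoiding ones then cancel
  -- exactly.
  have hsum : ((normMoment P A m - N ^ m * v ^ m : ℝ) : ℂ) =
      ∑ p : Fin m → Fin N, (T p - (v : ℂ) ^ m) := by
    rw [Finset.sum_sub_distrib, Complex.ofReal_sub, hA.ofReal_normMoment m i,
      hA.momentKernel_apply_eq_sum]
    simp [T]
  rw [← Real.norm_eq_abs, ← Complex.norm_real, hsum]
  calc ‖∑ p : Fin m → Fin N, (T p - (v : ℂ) ^ m)‖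
      ≤ ∑ p : Fin m → Fin N, if Function.Injective (vertexSeq i p) then 0 else
          ((m ^ m : ℕ) * C + v ^ m) := by
        refine norm_sum_le_of_le _ fun p _ => ?_
        split_ifs with h
        · rw [hgood p h, sub_self, norm_zero]
        · refine (norm_sub_le _ _).trans (add_le_add (hbad p) ?_)
          simp
    _ = ((N : ℝ) ^ m - Fintype.card {p : Fin m → Fin N // Function.Injective (vertexSeq i p)}) *
          ((m ^ m : ℕ) * C + v ^ m) := by
        have hc := Fintype.card_subtype_compl fun p : Fin m → Fin N =>
          Function.Injective (vertexSeq i p)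
        have hle := Fintype.card_subtype_le fun p : Fin m → Fin N =>
          Function.Injective (vertexSeq i p)
        rw [Finset.sum_ite, Finset.sum_const_zero, zero_add, Finset.sum_const, nsmul_eq_mul,
          ← Fintype.card_subtype, hc, Nat.cast_sub hle]
        simp
    _ ≤ _ := by
        gcongr
        exact_mod_cast pow_le_card_injective i m

/-- A row has `N` entries of second moment `v`. Exactness matters: it makes domination fail at every
size when `τ > 1`, beyond the asymptotic statement. -/
lemma normMoment_one (hA : IsComplexGinibre P A v) (hN : 1 ≤ N) :
    normMoment P A 1 = N * v := by
  set i : Fin N := ⟨0, hN⟩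
  have h : ∀ ω, (A ω ^ 1 * (A ω ^ 1).conjTranspose) i i =
      ((∑ j, ‖A ω i j‖ ^ 2 : ℝ) : ℂ) := by
    intro ω
    simp [Matrix.mul_apply, Complex.mul_conj, Complex.normSq_eq_norm_sq]
  have e := hA.ofReal_normMoment 1 i
  simp only [momentKernel, Matrix.of_apply] at e
  simp_rw [h] at e
  rw [integral_complex_ofReal, integral_finsetSum _ fun j _ => hA.integrable_norm_pow i j 2] at e
  simp_rw [hA.integral_norm_pow, integral_norm_sq_complexGaussian] at e
  simpa using Complex.ofReal_injective e

end IsComplexGinibre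

end MomentKernel

/-- The normalized moments of Ginibre matrices of entry variance `τ / N` converge to `τ ^ m`. -/
lemma tendsto_normMoment {Ω : ℕ → Type*} [∀ N, MeasurableSpace (Ω N)]
    {P : (N : ℕ) → Measure (Ω N)} [∀ N, IsProbabilityMeasure (P N)] {τ : ℝ≥0}
    {A : (N : ℕ) → Ω N → Matrix (Fin N) (Fin N) ℂ}
    (hA : ∀ N, IsComplexGinibre (P N) (A N) (τ / N)) (m : ℕ) :
    Tendsto (fun N => normMoment (P N) (A N) m) atTop (𝓝 ((τ : ℝ) ^ m)) := by
  rw [tendsto_iff_dist_tendsto_zero]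
  set D : ℝ := τ ^ m * ((m ^ m : ℕ) * ((2 * m + 1) * (∫ z, ‖z‖ ^ (2 * m) ∂complexGaussian 1)) + 1)
  have hlim : Tendsto (fun N : ℕ => (1 - (1 - (m : ℝ) / N) ^ m) * D) atTop (𝓝 0) := by
    have h := ((tendsto_const_div_atTop_nhds_zero_nat (m : ℝ)).const_sub 1).pow m
    simpa using (h.const_sub 1).mul_const D
  refine squeeze_zero' (.of_forall fun N => dist_nonneg) ?_ hlim
  -- From here on the truncated subtraction `N - m` is genuine and `N` is nonzero.
  filter_upwards [eventually_ge_atTop (m + 1)] with N hN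
  have hN0 : (N : ℝ) ≠ 0 := by exact_mod_cast (by omega : N ≠ 0)
  have h := (hA N).abs_normMoment_sub_le (by omega) m
  rw [Nat.cast_sub (by omega)] at h
  rw [Real.dist_eq]
  convert h using 1
  · congr 2
    push_cast
    rw [← mul_pow, mul_div_cancel₀ _ hN0]
  · have e : (1 - (m : ℝ) / N) = (N - m) / N := by field_simp
    simp only [D, NNReal.coe_div, NNReal.coe_natCast, e, div_pow]
    field_simp

/-! ### The order on kernels which are scalar at each level -/

/-- The kernel `(m, n) ↦ δ_{mn} d_m I_N`. -/
def scalarKernel (N : ℕ) (d : ℕ → ℝ) (m n : ℕ) : Matrix (Fin N) (Fin N) ℂ :=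
  if m = n then (d m : ℂ) • 1 else 0

lemma limitKernel_eq (τ : ℝ≥0) (N : ℕ) :
    limitKernel τ N = scalarKernel N fun m => (τ : ℝ) ^ m := by
  ext m n
  simp [limitKernel, scalarKernel]

lemma shiftKernel_scalarKernel (N : ℕ) (d : ℕ → ℝ) :
    shiftKernel (scalarKernel N d) = scalarKernel N fun m => d (m + 1) := by
  ext m n
  simp [shiftKernel, scalarKernel]

lemma smul_scalarKernel (N : ℕ) (c : ℝ) (d : ℕ → ℝ) :
    (c : ℂ) • scalarKernel N d = scalarKernel N fun m => c * d m := by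
  ext m n i j
  by_cases h : m = n <;> simp [scalarKernel, h, mul_assoc]

lemma scalarKernel_sub (N : ℕ) (d e : ℕ → ℝ) :
    scalarKernel N d - scalarKernel N e = scalarKernel N fun m => d m - e m := by
  ext m n i j
  by_cases h : m = n <;> simp [scalarKernel, h, sub_mul]

open scoped ComplexOrder in
-- Grouping the vectors by level turns the form into `∑_l d_l ‖∑_{x_a = l} u_a‖²`. Conversely, one
-- basis vector placed at level `m` reads off `d m`.
lemma isPosDefKernelOn_scalarKernel {N : ℕ} (hN : 1 ≤ N) (S : Set ℕ) (d : ℕ → ℝ) :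
    IsPosDefKernelOn S (scalarKernel N d) ↔ ∀ m ∈ S, 0 ≤ d m := by
  constructor
  · intro h m hm
    have h1 := h 1 (fun _ => m) (fun _ => Pi.single ⟨0, hN⟩ 1) fun _ => hm
    simpa [scalarKernel] using h1
  · intro h k x u hx
    have hterm : ∀ a b, star (u a) ⬝ᵥ (scalarKernel N d (x a) (x b)).mulVec (u b) =
        ∑ l ∈ Finset.univ.image x, (d l : ℂ) *
          ((if x a = l then star (u a) else 0) ⬝ᵥ (if x b = l then u b else 0)) := by
      intro a b
      rw [Finset.sum_eq_single (x a)]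
      · by_cases hab : x a = x b
        · simp [scalarKernel, hab, Matrix.smul_mulVec]
        · simp [scalarKernel, hab, Ne.symm hab]
      · intro l _ hl
        simp [hl.symm]
      · simp
    simp_rw [hterm]
    have hsum : ∑ a, ∑ b, ∑ l ∈ Finset.univ.image x, (d l : ℂ) *
          ((if x a = l then star (u a) else 0) ⬝ᵥ (if x b = l then u b else 0)) =
        ∑ l ∈ Finset.univ.image x, (d l : ℂ) *
          (star (∑ a, if x a = l then u a else 0) ⬝ᵥ ∑ b, if x b = l then u b else 0) := by
      simp_rw [Finset.sum_comm (t := Finset.univ.image x)]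
      refine Finset.sum_congr rfl fun l _ => ?_
      simp_rw [star_sum, sum_dotProduct, dotProduct_sum, Finset.mul_sum, apply_ite star, star_zero]
    rw [hsum]
    refine Finset.sum_nonneg fun l hl => mul_nonneg ?_ (dotProduct_star_self_nonneg _)
    obtain ⟨a, -, rfl⟩ := Finset.mem_image.1 hl
    exact_mod_cast h _ (hx a)

lemma kernelLEOn_scalarKernel {N : ℕ} (hN : 1 ≤ N) (S : Set ℕ) (d e : ℕ → ℝ) :
    KernelLEOn S (scalarKernel N d) (scalarKernel N e) ↔ ∀ m ∈ S, d m ≤ e m := by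
  simp_rw [KernelLEOn, scalarKernel_sub, isPosDefKernelOn_scalarKernel hN, sub_nonneg]

lemma kernelLEOn_limitKernel_iff {N : ℕ} (hN : 1 ≤ N) (τ : ℝ≥0) :
    KernelLEOn Set.univ (shiftKernel (limitKernel τ N)) (limitKernel τ N) ↔ τ ≤ 1 := by
  rw [limitKernel_eq, shiftKernel_scalarKernel, kernelLEOn_scalarKernel hN]
  constructor
  · intro h
    simpa using h 0 (Set.mem_univ 0)
  · intro h m _
    exact pow_le_pow_of_le_one τ.2 (by exact_mod_cast h) m.le_succ

/-- The moments are multiples of the identity, which a unital linear map fixes, so localization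
changes nothing. -/
lemma IsComplexGinibre.localKernel_eq {Ω : Type*} [MeasurableSpace Ω] {P : Measure Ω}
    [IsProbabilityMeasure P] {N : ℕ} {A : Ω → Matrix (Fin N) (Fin N) ℂ} {v : ℝ≥0}
    (hA : IsComplexGinibre P A v) {B : StarSubalgebra ℂ (Matrix (Fin N) (Fin N) ℂ)}
    {E : Matrix (Fin N) (Fin N) ℂ →ₗ[ℂ] Matrix (Fin N) (Fin N) ℂ} (hE : IsCondExp B E) :
    localKernel P A E = scalarKernel N (normMoment P A) := by
  ext1 m
  ext1 n
  rw [localKernel, scalarKernel, hA.momentKernel_eq]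
  split_ifs
  · rw [map_smul, hE.map_one]
  · exact map_zero E

open scoped Matrix.Norms.L2Operator in
lemma asymptoticallyEqual_scalarKernel {d : ℕ → ℕ → ℝ} {e : ℕ → ℝ}
    (h : ∀ m, Tendsto (fun N => d N m) atTop (𝓝 (e m))) :
    AsymptoticallyEqual (fun N => scalarKernel N (d N)) fun N => scalarKernel N e := by
  intro m n
  have h0 : Tendsto (fun N => |d N m - e m|) atTop (𝓝 0) := by
    simpa using ((h m).sub_const (e m)).abs
  refine squeeze_zero' (.of_forall fun N => norm_nonneg _) ?_ h0
  filter_upwards [eventually_ge_atTop 1] with N hN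
  have : NeZero N := ⟨by omega⟩
  rcases eq_or_ne m n with rfl | hmn
  · simp only [scalarKernel, if_true]
    rw [← sub_smul, norm_smul, CStarRing.norm_one, mul_one, ← Complex.ofReal_sub,
      Complex.norm_real, Real.norm_eq_abs]
  · simp [scalarKernel, hmn]

end GinibreKernel

/-! ### The asymptotic criterion -/

theorem mainTheorem8
    {Ω : ℕ → Type*} [∀ N, MeasurableSpace (Ω N)]
    (P : (N : ℕ) → Measure (Ω N)) [∀ N, IsProbabilityMeasure (P N)]
    (τ : ℝ≥0) (hτ : 0 < τ)
    (A : (N : ℕ) → Ω N → Matrix (Fin N) (Fin N) ℂ)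
    (hA : ∀ N, GinibreKernel.IsComplexGinibre (P N) (A N) (τ / N))
    (B : (N : ℕ) → StarSubalgebra ℂ (Matrix (Fin N) (Fin N) ℂ))
    (E : (N : ℕ) → Matrix (Fin N) (Fin N) ℂ →ₗ[ℂ] Matrix (Fin N) (Fin N) ℂ)
    (hE : ∀ N, GinibreKernel.IsCondExp (B N) (E N)) :
    -- the moments exist
    (∀ (N m n : ℕ) (i j : Fin N),
      Integrable (fun ω => (A N ω ^ m * (A N ω ^ n).conjTranspose) i j) (P N)) ∧
    -- convergence of the normalized moments
    (∀ m : ℕ, Tendsto (fun N => GinibreKernel.normMoment (P N) (A N) m) atTop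
      (𝓝 ((τ : ℝ) ^ m))) ∧
    -- convergence of the moment ratios
    (∀ m : ℕ, Tendsto (fun N => GinibreKernel.normMoment (P N) (A N) (m + 1) /
      GinibreKernel.normMoment (P N) (A N) m) atTop (𝓝 (τ : ℝ))) ∧
    -- the kernels converge to `δ_{mn} τ^m I_N`, and the criterion for the limiting kernel
    GinibreKernel.AsymptoticallyEqual
      (fun N => GinibreKernel.localKernel (P N) (A N) (E N))
      (GinibreKernel.limitKernel τ) ∧
    (∀ N : ℕ, 1 ≤ N → (GinibreKernel.KernelLEOn Set.univ
        (GinibreKernel.shiftKernel (GinibreKernel.limitKernel τ N))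
        (GinibreKernel.limitKernel τ N) ↔ τ ≤ 1)) ∧
    -- the sharp asymptotic criterion for the kernels themselves
    (GinibreKernel.AsymptoticallyDominated
        (fun N => GinibreKernel.shiftKernel (GinibreKernel.localKernel (P N) (A N) (E N)))
        (fun N => GinibreKernel.localKernel (P N) (A N) (E N)) ↔ τ ≤ 1) ∧
    -- below the threshold, domination on any finite set of levels is eventually exact
    (τ < 1 → ∀ M : ℕ, ∀ᶠ N in atTop, GinibreKernel.KernelLEOn (Set.Iic M)
        (GinibreKernel.shiftKernel (GinibreKernel.localKernel (P N) (A N) (E N)))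
        (GinibreKernel.localKernel (P N) (A N) (E N))) ∧
    -- above the threshold, domination fails for every size, already at level zero
    (1 < τ → ∀ N : ℕ, 1 ≤ N → ¬ GinibreKernel.KernelLEOn {0}
        (GinibreKernel.shiftKernel (GinibreKernel.localKernel (P N) (A N) (E N)))
        (GinibreKernel.localKernel (P N) (A N) (E N))) := by
  have hpos : ∀ m : ℕ, (0 : ℝ) < τ ^ m := fun m => pow_pos (by exact_mod_cast hτ) m
  have hlim := GinibreKernel.tendsto_normMoment hA
  have hK : (fun N => GinibreKernel.localKernel (P N) (A N) (E N)) =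
      fun N => GinibreKernel.scalarKernel N (GinibreKernel.normMoment (P N) (A N)) :=
    funext fun N => (hA N).localKernel_eq (hE N)
  have hratio : ∀ m : ℕ, Tendsto (fun N => GinibreKernel.normMoment (P N) (A N) (m + 1) /
      GinibreKernel.normMoment (P N) (A N) m) atTop (𝓝 (τ : ℝ)) := by
    intro m
    have h := (hlim (m + 1)).div (hlim m) (hpos m).ne'
    rwa [pow_succ, mul_div_cancel_left₀ _ (hpos m).ne'] at h
  -- Only finitely many levels are involved, so the eventual ratio bounds hold simultaneously; `c_m`
  -- is eventually positive because its limit is, which clears the denominator.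
  have hdom : ∀ c : ℝ, (τ : ℝ) < c → ∀ M : ℕ, ∀ᶠ N in atTop, ∀ m ∈ Set.Iic M,
      GinibreKernel.normMoment (P N) (A N) (m + 1) ≤
        c * GinibreKernel.normMoment (P N) (A N) m := by
    intro c hc M
    refine (Set.finite_Iic M).eventually_all.2 fun m _ => ?_
    filter_upwards [(hratio m).eventually_lt_const hc, (hlim m).eventually_const_lt (hpos m)]
      with N h1 h2
    exact ((div_lt_iff₀ h2).1 h1).le
  have hone : ∀ N : ℕ, 1 ≤ N → GinibreKernel.normMoment (P N) (A N) 1 = τ := by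
    intro N hN
    have hN0 : (N : ℝ) ≠ 0 := by exact_mod_cast (by omega : N ≠ 0)
    rw [(hA N).normMoment_one hN]
    push_cast
    exact mul_div_cancel₀ _ hN0
  refine ⟨fun N m n i j => (hA N).integrable_pow_mul_conjTranspose_pow m n i j, hlim, hratio,
    ?_, fun N hN => GinibreKernel.kernelLEOn_limitKernel_iff hN τ, ⟨fun h => ?_, fun h => ?_⟩,
    fun h M => ?_, fun h N hN hle => ?_⟩
  · have hL : GinibreKernel.limitKernel τ =
        fun N => GinibreKernel.scalarKernel N fun m => (τ : ℝ) ^ m :=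
      funext fun N => GinibreKernel.limitKernel_eq τ N
    rw [hK, hL]
    exact GinibreKernel.asymptoticallyEqual_scalarKernel hlim
  · rw [← NNReal.coe_le_coe, NNReal.coe_one]
    -- Level zero at a single size `N ≥ 1` reads `τ ≤ 1 + ε`.
    refine le_of_forall_pos_le_add fun ε hε => ?_
    obtain ⟨N, h1, hN⟩ := ((h ε hε 0).and (eventually_ge_atTop 1)).exists
    beta_reduce at h1
    rw [(hA N).localKernel_eq (hE N), GinibreKernel.shiftKernel_scalarKernel,
      GinibreKernel.smul_scalarKernel, GinibreKernel.kernelLEOn_scalarKernel hN] at h1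
    simpa [hone N hN, (hA N).normMoment_zero hN] using h1 0 (Set.mem_Iic.2 le_rfl)
  · intro ε hε M
    -- The slack `ε` provides the strict inequality also at `τ = 1`.
    have hc : (τ : ℝ) < 1 + ε := by
      have : (τ : ℝ) ≤ 1 := by exact_mod_cast h
      linarith
    filter_upwards [hdom _ hc M, eventually_ge_atTop 1] with N h1 hN
    rw [(hA N).localKernel_eq (hE N), GinibreKernel.shiftKernel_scalarKernel,
      GinibreKernel.smul_scalarKernel, GinibreKernel.kernelLEOn_scalarKernel hN]
    exact h1
  -- For `τ < 1` the constant `1` already exceeds the limiting ratio, so no `ε` is needed.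
  · filter_upwards [hdom 1 (by exact_mod_cast h) M, eventually_ge_atTop 1] with N h1 hN
    rw [(hA N).localKernel_eq (hE N), GinibreKernel.shiftKernel_scalarKernel,
      GinibreKernel.kernelLEOn_scalarKernel hN]
    simpa using h1
  · rw [(hA N).localKernel_eq (hE N), GinibreKernel.shiftKernel_scalarKernel,
      GinibreKernel.kernelLEOn_scalarKernel hN] at hle
    have h1 := hle 0 rfl
    rw [zero_add, hone N hN, (hA N).normMoment_zero hN] at h1
    exact absurd h (not_lt.2 (by exact_mod_cast h1))
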